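/- Let $(M,g)$ be a compact connected smooth Riemannian manifold (without boundary) of dimension $m\ge 0$. For complex-valued functions $\phi,\psi$ of class $C^2$ on $M$ (in particular for smooth ones), let $\tau(\phi)=\operatorname{div}(\nabla\phi)$ be the Laplace–Beltrami operator and $\kappa(\phi,\psi)=g(\nabla\phi,\nabla\psi)$, where $g$ is extended complex bilinearly to the complexified tangent bundle; in local coordinates $$\tau(\phi)=\sum_{i,j=1}^m\frac{1}{\sqrt{|g|}}\frac{\partial}{\partial x_j}\Big(g^{ij}\sqrt{|g|}\,\frac{\partial\phi}{\partial x_i}\Big),\qquad \kappa(\phi,\psi)=\sum_{i,j=1}^m g^{ij}\,\frac{\partial\phi}{\partial x_i}\frac{\partial\psi}{\partial x_j},$$ where $(g^{ij})$ is the inverse of the matrix $(g_{ij})$ of $g$ and $|g|=\det(g_{ij})$. For $\lambda,\mu\in\mathbb{C}$, a set $\mathcal F$ of such functions is called a $(\lambda,\mu)$-eigenfamily if $\tau(\phi)=\lambda\,\phi$ and $\kappa(\phi,\psi)=\mu\,\phi\,\psi$ on $M$ for all $\phi,\psi\in\mathcal F$. Let $\lambda\in\mathbb{C}$ and let $\mathcal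 F$ be a $(\lambda,\lambda)$-eigenfamily on $M$. Then $\dim_{\mathbb C}\big(\operatorname{span}_{\mathbb C}(\mathcal F)\big)\le 1$. -/

import Mathlib

open scoped Manifold ContDiff Bundle

noncomputable section

namespace Eigenfamily

/-- The model space `ℝⁿ`. -/
abbrev Model (n : ℕ) : Type := EuclideanSpace ℝ (Fin n)

/-- A smooth Riemannian metric on the tangent bundle of a smooth `n`-manifold `M`. -/
abbrev Metric (n : ℕ) (M : Type*) [TopologicalSpace M] [ChartedSpace (Model n) M]
    [IsManifold (𝓡 n) ∞ M] :=
  Bundle.ContMDiffRiemannianMetric (𝓡 n) ∞ (Model n) (fun x : M ↦ TangentSpace (𝓡 n) x)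

/-- The partial derivative `∂f/∂x_i` at `y` of a complex-valued function on `ℝⁿ`. -/
def partialDeriv {n : ℕ} (i : Fin n) (f : Model n → ℂ) (y : Model n) : ℂ :=
  fderiv ℝ f y (EuclideanSpace.single i 1)

variable {n : ℕ} {M : Type*} [TopologicalSpace M] [ChartedSpace (Model n) M]

/-- The coordinate vector field `∂/∂x_i` of the chart `e`, at the point with coordinates `y`. -/
def coordVector (e : OpenPartialHomeomorph M (Model n)) (i : Fin n) (y : Model n) :
    TangentSpace (𝓡 n) (e.symm y) :=
  mfderiv (𝓡 n) (𝓡 n) e.symm y (EuclideanSpace.single i (1 : ℝ) : Model n)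

variable [IsManifold (𝓡 n) ∞ M]

/-- The matrix `(g_ij)` of the metric in the chart `e`, as a function of the coordinates. -/
def metricMatrix (g : Metric n M) (e : OpenPartialHomeomorph M (Model n)) (y : Model n) :
    Matrix (Fin n) (Fin n) ℝ :=
  Matrix.of fun i j ↦ g.inner (e.symm y) (coordVector e i y) (coordVector e j y)

/-- The Riemannian density `√|g|`, `|g| = det (g_ij)`, in the chart `e`. -/
def density (g : Metric n M) (e : OpenPartialHomeomorph M (Model n)) (y : Model n) : ℝ :=
  √(metricMatrix g e y).det

/-- The Laplace-Beltrami operator in the local coordinates given by the chart `e`: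
`τ(φ) = ∑ i j, (1/√|g|) ∂/∂x_j (g^ij √|g| ∂φ/∂x_i)` at the point `p` of the domain of `e`. -/
def tau (g : Metric n M) (e : OpenPartialHomeomorph M (Model n)) (φ : M → ℂ) (p : M) : ℂ :=
  ∑ i, ∑ j, ((1 / density g e (e p) : ℝ) : ℂ) *
    partialDeriv j (fun y ↦ (((metricMatrix g e y)⁻¹ i j * density g e y : ℝ) : ℂ) *
      partialDeriv i (φ ∘ e.symm) y) (e p)

/-- The conformality operator `κ(φ,ψ) = g(∇φ,∇ψ)` (with `g` extended complex bilinearly) in the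
local coordinates given by the chart `e`: `κ(φ,ψ) = ∑ i j, g^ij ∂φ/∂x_i ∂ψ/∂x_j`
at the point `p` of the domain of `e`. -/
def kappa (g : Metric n M) (e : OpenPartialHomeomorph M (Model n)) (φ ψ : M → ℂ) (p : M) : ℂ :=
  ∑ i, ∑ j, (((metricMatrix g e (e p))⁻¹ i j : ℝ) : ℂ) *
    partialDeriv i (φ ∘ e.symm) (e p) * partialDeriv j (ψ ∘ e.symm) (e p)

/-- A set `F` of complex-valued functions on `M` is a `(lam, mu)`-eigenfamily if
`τ(φ) = lam φ` and `κ(φ,ψ) = mu φ ψ` on `M` for all `φ, ψ ∈ F`, where `τ` and `κ` are computed in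
the charts of the atlas of `M`. The functions are of class `C²`, which is what `τ` requires;
this includes the smooth ones. -/
structure IsEigenfamily (g : Metric n M) (lam mu : ℂ) (F : Set (M → ℂ)) : Prop where
  contMDiff : ∀ φ ∈ F, ContMDiff (𝓡 n) 𝓘(ℝ, ℂ) 2 φ
  tau_eq : ∀ φ ∈ F, ∀ e ∈ atlas (Model n) M, ∀ p ∈ e.source, tau g e φ p = lam * φ p
  kappa_eq : ∀ φ ∈ F, ∀ ψ ∈ F, ∀ e ∈ atlas (Model n) M, ∀ p ∈ e.source,
    kappa g e φ ψ p = mu * (φ p * ψ p)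

end Eigenfamily

end

namespace Eigenfamily

section Metric

variable {n : ℕ} {M : Type*} [TopologicalSpace M] [ChartedSpace (Model n) M]
  [IsManifold (𝓡 n) ∞ M]

theorem contMDiffOn_chart_symm_of_mem_atlas {e : OpenPartialHomeomorph M (Model n)}
    (he : e ∈ atlas (Model n) M) :
    ContMDiffOn (𝓡 n) (𝓡 n) ∞ e.symm e.target :=
  contMDiffOn_symm_of_mem_maximalAtlas (IsManifold.subset_maximalAtlas he)

theorem contMDiffOn_coordVector {e : OpenPartialHomeomorph M (Model n)}
    (he : e ∈ atlas (Model n) M) (i : Fin n) :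
    ContMDiffOn (𝓡 n) (𝓡 n).tangent 1
      (fun y ↦ (⟨e.symm y, coordVector e i y⟩ : TangentBundle (𝓡 n) M)) e.target := by
  have h := (contMDiffOn_chart_symm_of_mem_atlas he).contMDiffOn_tangentMapWithin (m := 1)
    (by norm_cast) e.open_target.uniqueMDiffOn
  have hs : ContMDiff (𝓡 n) (𝓡 n).tangent 1 (fun y : Model n ↦
      (⟨y, EuclideanSpace.single i (1 : ℝ)⟩ : TangentBundle (𝓡 n) (Model n))) := by
    exact contMDiff_vectorSpace_iff_contDiff.2 contDiff_const
  refine (h.comp hs.contMDiffOn (fun y hy ↦ hy)).congr fun y hy ↦ ?_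
  simp only [Function.comp, tangentMapWithin, coordVector,
    mfderivWithin_of_isOpen e.open_target hy]

theorem contDiffOn_metricMatrix (g : Metric n M) {e : OpenPartialHomeomorph M (Model n)}
    (he : e ∈ atlas (Model n) M) (i j : Fin n) :
    ContDiffOn ℝ 1 (fun y ↦ metricMatrix g e y i j) e.target := by
  rw [← contMDiffOn_iff_contDiffOn]
  have h : ContMDiffOn (𝓡 n) ((𝓡 n).prod 𝓘(ℝ)) 1 (fun y ↦ Bundle.TotalSpace.mk' ℝ
      (E := Bundle.Trivial M ℝ) (e.symm y) (metricMatrix g e y i j)) e.target := by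
    apply ContMDiffOn.clm_bundle_apply₂ (F₁ := Model n) (F₂ := Model n)
      (E₁ := fun x : M ↦ TangentSpace (𝓡 n) x) (E₂ := fun x : M ↦ TangentSpace (𝓡 n) x)
    · exact (g.contMDiff.of_le (by norm_cast)).comp_contMDiffOn
        ((contMDiffOn_chart_symm_of_mem_atlas he).of_le (by norm_cast))
    · exact contMDiffOn_coordVector he i
    · exact contMDiffOn_coordVector he j
  intro y hy
  have := h y hy
  simp only [Bundle.contMDiffWithinAt_totalSpace] at this
  exact this.2

theorem bilinear_apply_sum {V : Type*} [AddCommGroup V] [Module ℝ V] [TopologicalSpace V]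
    [IsTopologicalAddGroup V] [ContinuousConstSMul ℝ V]
    (B : V →L[ℝ] V →L[ℝ] ℝ) (v : Fin n → V) (x : Fin n → ℝ) :
    B (∑ i, x i • v i) (∑ i, x i • v i) =
      star x ⬝ᵥ (Matrix.of (fun i j ↦ B (v i) (v j))).mulVec x := by
  simp only [map_sum, map_smul, dotProduct, Matrix.mulVec, Finset.mul_sum, Matrix.of_apply,
    FunLike.coe_sum, FunLike.coe_smul, Finset.sum_apply, Pi.smul_apply, smul_eq_mul,
    star_trivial]
  rw [Finset.sum_comm]
  exact Finset.sum_congr rfl fun _ _ ↦ Finset.sum_congr rfl fun _ _ ↦ by ring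

theorem posDef_metricMatrix (g : Metric n M) {e : OpenPartialHomeomorph M (Model n)}
    (he : e ∈ atlas (Model n) M) {y : Model n} (hy : y ∈ e.target) :
    (metricMatrix g e y).PosDef := by
  refine .of_dotProduct_mulVec_pos ?_ fun x hx ↦ ?_
  · ext i j
    simpa [metricMatrix] using g.symm _ _ _
  · let D : Model n →L[ℝ] TangentSpace (𝓡 n) (e.symm y) := mfderiv (𝓡 n) (𝓡 n) e.symm y
    have hD : Function.Injective D :=
      (mdifferentiable_of_mem_atlas (I := 𝓡 n) he).symm.mfderiv_injective hy
    have hx' : WithLp.toLp 2 x ≠ (0 : Model n) := by simpa using hx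
    have hp := g.pos (e.symm y) (D (WithLp.toLp 2 x)) (by
      rw [← map_zero D]; exact hD.ne hx')
    have hsum : D (WithLp.toLp 2 x) = ∑ i, x i • coordVector e i y := by
      have : WithLp.toLp 2 x = ∑ i, x i • (EuclideanSpace.single i (1 : ℝ) : Model n) := by
        ext k; simp [Finset.sum_apply, Pi.single_apply]
      rw [this, map_sum]
      simp only [map_smul]
      rfl
    rw [hsum] at hp
    exact hp.trans_eq (bilinear_apply_sum (g.inner (e.symm y)) (fun i ↦ coordVector e i y) x)

end Metric

section Matrix

variable {n : ℕ} {E : Type*} [NormedAddCommGroup E] [NormedSpace ℝ E] {k : WithTop ℕ∞} {s : Set E}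
  {A : E → Matrix (Fin n) (Fin n) ℝ}

theorem contDiffOn_det (hA : ∀ i j, ContDiffOn ℝ k (fun y ↦ A y i j) s) :
    ContDiffOn ℝ k (fun y ↦ (A y).det) s := by
  simp only [Matrix.det_apply']
  exact ContDiffOn.sum fun σ _ ↦ contDiffOn_const.mul (contDiffOn_prod fun i _ ↦ hA _ _)

theorem contDiffOn_adjugate (hA : ∀ i j, ContDiffOn ℝ k (fun y ↦ A y i j) s) (i j : Fin n) :
    ContDiffOn ℝ k (fun y ↦ (A y).adjugate i j) s := by
  simp only [Matrix.adjugate_apply]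
  refine contDiffOn_det fun a b ↦ ?_
  simp only [Matrix.updateRow_apply]
  split_ifs
  · exact contDiffOn_const
  · exact hA a b

theorem contDiffOn_inv_mul_sqrt_det (hA : ∀ i j, ContDiffOn ℝ k (fun y ↦ A y i j) s)
    (hdet : ∀ y ∈ s, (A y).det ≠ 0) (i j : Fin n) :
    ContDiffOn ℝ k (fun y ↦ (A y)⁻¹ i j * √(A y).det) s := by
  simp only [Matrix.inv_def, Matrix.smul_apply, smul_eq_mul, Ring.inverse_eq_inv]
  exact (((contDiffOn_det hA).inv hdet).mul (contDiffOn_adjugate hA i j)).mul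
    ((contDiffOn_det hA).sqrt hdet)

end Matrix

section DivGrad

variable {n : ℕ} {F F' : Type*} [NormedAddCommGroup F] [NormedSpace ℝ F]
  [NormedAddCommGroup F'] [NormedSpace ℝ F']
  {A : Model n → Matrix (Fin n) (Fin n) ℝ} {x : Model n}

/-- The divergence form operator `u ↦ ∑ i j, ∂_j (A_ij ∂_i u)`. -/
noncomputable def divGrad (A : Model n → Matrix (Fin n) (Fin n) ℝ) (u : Model n → F)
    (x : Model n) : F :=
  ∑ i, ∑ j, fderiv ℝ (fun y ↦ A y i j • fderiv ℝ u y (EuclideanSpace.single i (1 : ℝ))) x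
    (EuclideanSpace.single j (1 : ℝ))

theorem differentiableAt_fderiv {u : Model n → F} (hu : ContDiffAt ℝ 2 u x) :
    DifferentiableAt ℝ (fderiv ℝ u) x :=
  (hu.fderiv_right (m := 1) (by norm_num)).differentiableAt (by norm_num)

theorem eventually_differentiableAt {u : Model n → F} (hu : ContDiffAt ℝ 2 u x) :
    ∀ᶠ y in nhds x, DifferentiableAt ℝ u y :=
  (hu.eventually (by simp)).mono fun _ h ↦ h.differentiableAt (by norm_num)

theorem divGrad_eq (hA : ∀ i j, DifferentiableAt ℝ (fun y ↦ A y i j) x) {u : Model n → F}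
    (hu : ContDiffAt ℝ 2 u x) :
    divGrad A u x = ∑ i, ∑ j,
      (A x i j • fderiv ℝ (fderiv ℝ u) x (EuclideanSpace.single j (1 : ℝ))
          (EuclideanSpace.single i (1 : ℝ)) +
        fderiv ℝ (fun y ↦ A y i j) x (EuclideanSpace.single j (1 : ℝ)) •
          fderiv ℝ u x (EuclideanSpace.single i (1 : ℝ))) := by
  unfold divGrad
  refine Finset.sum_congr rfl fun i _ ↦ Finset.sum_congr rfl fun j _ ↦ ?_
  have h := (differentiableAt_fderiv hu).hasFDerivAt.clm_apply
    (hasFDerivAt_const (EuclideanSpace.single i (1 : ℝ)) x)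
  rw [((hA i j).hasFDerivAt.fun_smul h).fderiv]
  simp

theorem divGrad_clm_comp (hA : ∀ i j, DifferentiableAt ℝ (fun y ↦ A y i j) x) {u : Model n → F}
    (hu : ContDiffAt ℝ 2 u x) (L : F →L[ℝ] F') :
    divGrad A (fun y ↦ L (u y)) x = L (divGrad A u x) := by
  have h1 : fderiv ℝ (fun y ↦ L (u y)) =ᶠ[nhds x] fun y ↦ L.comp (fderiv ℝ u y) :=
    (eventually_differentiableAt hu).mono fun y hy ↦
      (L.hasFDerivAt.comp y hy.hasFDerivAt).fderiv
  have h2 := ((hasFDerivAt_const L x).clm_comp (differentiableAt_fderiv hu).hasFDerivAt).fderiv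
  rw [divGrad_eq (u := fun y ↦ L (u y)) hA (L.contDiff.contDiffAt.comp x hu), divGrad_eq hA hu, h1.fderiv_eq, h2,
    h1.eq_of_nhds]
  simp

theorem divGrad_add (hA : ∀ i j, DifferentiableAt ℝ (fun y ↦ A y i j) x) {u v : Model n → F}
    (hu : ContDiffAt ℝ 2 u x) (hv : ContDiffAt ℝ 2 v x) :
    divGrad A (fun y ↦ u y + v y) x = divGrad A u x + divGrad A v x := by
  have h1 : fderiv ℝ (fun y ↦ u y + v y) =ᶠ[nhds x] fun y ↦ fderiv ℝ u y + fderiv ℝ v y := by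
    filter_upwards [eventually_differentiableAt hu, eventually_differentiableAt hv] with y h h'
    exact fderiv_fun_add h h'
  rw [divGrad_eq hA (hu.add hv), divGrad_eq hA hu, divGrad_eq hA hv, h1.fderiv_eq, h1.eq_of_nhds,
    fderiv_fun_add (differentiableAt_fderiv hu) (differentiableAt_fderiv hv)]
  simp only [← Finset.sum_add_distrib, add_apply, smul_add]
  exact Finset.sum_congr rfl fun _ _ ↦ Finset.sum_congr rfl fun _ _ ↦ by abel

theorem divGrad_sq (hA : ∀ i j, DifferentiableAt ℝ (fun y ↦ A y i j) x)
    {u : Model n → ℝ} (hu : ContDiffAt ℝ 2 u x) :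
    divGrad A (fun y ↦ u y ^ 2) x = 2 * u x * divGrad A u x +
      2 * ∑ i, ∑ j, A x i j * fderiv ℝ u x (EuclideanSpace.single i (1 : ℝ)) *
        fderiv ℝ u x (EuclideanSpace.single j (1 : ℝ)) := by
  have h1 : fderiv ℝ (fun y ↦ u y ^ 2) =ᶠ[nhds x] fun y ↦ (2 * u y) • fderiv ℝ u y := by
    filter_upwards [eventually_differentiableAt hu] with y h
    simpa using (h.hasFDerivAt.pow 2).fderiv
  have h2 := (((hu.differentiableAt (by norm_num)).hasFDerivAt.const_mul 2).fun_smul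
    (differentiableAt_fderiv hu).hasFDerivAt).fderiv
  rw [divGrad_eq hA (hu.pow 2), divGrad_eq hA hu, h1.fderiv_eq, h1.eq_of_nhds, h2]
  simp only [Finset.mul_sum, ← Finset.sum_add_distrib]
  refine Finset.sum_congr rfl fun _ _ ↦ Finset.sum_congr rfl fun _ _ ↦ ?_
  simp
  ring

theorem continuousOn_divGrad {Ω : Set (Model n)} (hΩ : IsOpen Ω)
    (hA : ∀ i j, ContDiffOn ℝ 1 (fun y ↦ A y i j) Ω) {u : Model n → F}
    (hu : ContDiffOn ℝ 2 u Ω) : ContinuousOn (divGrad A u) Ω := by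
  refine continuousOn_finsetSum _ fun i _ ↦ continuousOn_finsetSum _ fun j _ ↦ ?_
  have h : ContDiffOn ℝ 1 (fun y ↦ A y i j • fderiv ℝ u y (EuclideanSpace.single i (1 : ℝ))) Ω :=
    (hA i j).smul ((hu.fderiv_of_isOpen hΩ (by norm_num)).clm_apply contDiffOn_const)
  exact (h.continuousOn_fderiv_of_isOpen hΩ le_rfl).clm_apply continuousOn_const

theorem fderiv_fderiv_apply_self_nonpos_of_isLocalMax {u : Model n → ℝ}
    (hu : ContDiffAt ℝ 2 u x) (hmax : IsLocalMax u x) (b : Model n) :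
    fderiv ℝ (fderiv ℝ u) x b b ≤ 0 := by
  let l : ℝ → Model n := fun t ↦ x + t • b
  have hl : ∀ t, HasDerivAt l b t := fun t ↦ by
    simpa only [one_smul, id] using ((hasDerivAt_id t).smul_const b).const_add x
  have hl0 : l 0 = x := by simp [l]
  have hc : Filter.Tendsto l (nhds 0) (nhds x) := by
    simpa [hl0] using (hl 0).continuousAt.tendsto
  have hd : deriv (u ∘ l) =ᶠ[nhds 0] fun t ↦ fderiv ℝ u (l t) b :=
    (hc.eventually (eventually_differentiableAt hu)).mono fun t ht ↦
      (ht.hasFDerivAt.comp_hasDerivAt t (hl t)).deriv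
  have hdd : deriv (deriv (u ∘ l)) 0 = fderiv ℝ (fderiv ℝ u) x b b := by
    have h := differentiableAt_fderiv hu
    rw [← hl0] at h
    have h' := ((h.hasFDerivAt.comp_hasDerivAt (0 : ℝ) (hl 0)).clm_apply
      (hasDerivAt_const (0 : ℝ) b)).deriv
    simp only [Function.comp_apply] at h'
    rw [hd.deriv_eq, h']
    simp [hl0]
  have hm : IsLocalMax (u ∘ l) 0 := by
    filter_upwards [hc.eventually hmax] with t ht
    simpa [hl0] using ht
  by_contra! hpos
  have hcont : ContinuousAt (u ∘ l) 0 :=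
    ContinuousAt.comp (by rw [hl0]; exact hu.continuousAt) (hl 0).continuousAt
  have hmin := isLocalMin_of_deriv_deriv_pos (by rw [hdd]; exact hpos) hm.deriv_eq_zero hcont
  have hconst : u ∘ l =ᶠ[nhds 0] fun _ ↦ (u ∘ l) 0 := by
    filter_upwards [hm, hmin] with t h h' using le_antisymm h h'
  rw [← hdd, hconst.deriv.deriv_eq] at hpos
  simp at hpos

open scoped MatrixOrder in
theorem divGrad_nonpos_of_isLocalMax (hA : ∀ i j, DifferentiableAt ℝ (fun y ↦ A y i j) x)
    (hpos : (A x).PosSemidef) {u : Model n → ℝ} (hu : ContDiffAt ℝ 2 u x)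
    (hmax : IsLocalMax u x) : divGrad A u x ≤ 0 := by
  obtain ⟨B, hB⟩ := CStarAlgebra.nonneg_iff_eq_star_mul_self.mp hpos.nonneg
  have key : divGrad A u x = ∑ k, fderiv ℝ (fderiv ℝ u) x
      (∑ j, B k j • EuclideanSpace.single j (1 : ℝ))
      (∑ i, B k i • EuclideanSpace.single i (1 : ℝ)) := by
    rw [divGrad_eq hA hu, hmax.fderiv_eq_zero, hB]
    simp only [map_sum, map_smul, Matrix.mul_apply, Matrix.star_apply, star_trivial,
      FunLike.coe_sum, FunLike.coe_smul, Finset.sum_apply, Pi.smul_apply, smul_eq_mul,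
      Finset.sum_mul, Finset.mul_sum, zero_apply, mul_zero, add_zero]
    rw [Finset.sum_comm_cycle]
    exact Finset.sum_congr rfl fun _ _ ↦ Finset.sum_congr rfl fun _ _ ↦
      Finset.sum_congr rfl fun _ _ ↦ by ring
  rw [key]
  exact Finset.sum_nonpos fun k _ ↦ fderiv_fderiv_apply_self_nonpos_of_isLocalMax hu hmax _

end DivGrad

section MaximumPrinciple

variable {n : ℕ} {A : Model n → Matrix (Fin n) (Fin n) ℝ} {Ω : Set (Model n)} {u : Model n → ℝ}

theorem contDiff_sq_sub_norm_sub_sq (c : ℝ) (z : Model n) {k : WithTop ℕ∞} :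
    ContDiff ℝ k (fun x : Model n ↦ c - ‖x - z‖ ^ 2) :=
  contDiff_const.sub ((contDiff_id.sub contDiff_const).norm_sq ℝ)

theorem fderiv_sq_sub_norm_sub_sq (c : ℝ) (z y : Model n) (i : Fin n) :
    fderiv ℝ (fun x : Model n ↦ c - ‖x - z‖ ^ 2) y (EuclideanSpace.single i (1 : ℝ)) =
      -2 * (y - z) i := by
  have h := (((hasFDerivAt_id (𝕜 := ℝ) y).sub_const z).norm_sq.const_sub c).fderiv
  simp only [id] at h
  rw [h]
  simp [EuclideanSpace.inner_single_right]

theorem sum_sum_mul_eq_dotProduct (B : Matrix (Fin n) (Fin n) ℝ) (v : Fin n → ℝ) :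
    ∑ i, ∑ j, B i j * v i * v j = star v ⬝ᵥ B.mulVec v := by
  simp only [dotProduct, Matrix.mulVec, Finset.mul_sum, star_trivial]
  exact Finset.sum_congr rfl fun _ _ ↦ Finset.sum_congr rfl fun _ _ ↦ by ring

/-- A function vanishing on the sphere through `y` centred at `z`, negative outside that sphere
near `y`, and a strict subsolution near `y`. -/
theorem exists_barrier (hΩ : IsOpen Ω) (hA : ∀ i j, ContDiffOn ℝ 1 (fun y ↦ A y i j) Ω)
    {y z : Model n} (hy : y ∈ Ω) (hpos : (A y).PosDef) (hyz : y ≠ z) :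
    ∃ v : Model n → ℝ, ContDiff ℝ 2 v ∧ v y = 0 ∧ (∀ᶠ x in nhds y, 0 < divGrad A v x) ∧
      ∀ᶠ x in nhds y, dist y z < dist x z → v x < 0 := by
  have hAy : ∀ i j, DifferentiableAt ℝ (fun y ↦ A y i j) y := fun i j ↦
    ((hA i j).contDiffAt (hΩ.mem_nhds hy)).differentiableAt (by norm_num)
  let s : Model n → ℝ := fun x ↦ ‖y - z‖ ^ 2 - ‖x - z‖ ^ 2
  have hs : ContDiff ℝ 2 s := contDiff_sq_sub_norm_sub_sq _ z
  have hsy : s y = 0 := by simp [s]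
  let q : ℝ := ∑ i, ∑ j, A y i j * fderiv ℝ s y (EuclideanSpace.single i (1 : ℝ)) *
        fderiv ℝ s y (EuclideanSpace.single j (1 : ℝ))
  have hq : 0 < q := by
    have hne : (fun i ↦ fderiv ℝ s y (EuclideanSpace.single i (1 : ℝ))) ≠ 0 := by
      intro h0
      apply hyz
      rw [← sub_eq_zero]
      ext i
      have := congrFun h0 i
      simp only [s, fderiv_sq_sub_norm_sub_sq] at this
      simpa using this
    have := hpos.dotProduct_mulVec_pos hne
    rwa [← sum_sum_mul_eq_dotProduct] at this
  obtain ⟨N, hN⟩ : ∃ N : ℝ, 0 < divGrad A s y + N * (2 * q) := by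
    refine ⟨(1 - divGrad A s y) / (2 * q), ?_⟩
    rw [div_mul_cancel₀ _ (by positivity)]
    simp
  have hNs : ContDiff ℝ 2 (fun x ↦ N * s x ^ 2) := contDiff_const.mul (hs.pow 2)
  have hv : ContDiff ℝ 2 (fun x ↦ s x + N * s x ^ 2) := hs.add hNs
  refine ⟨fun x ↦ s x + N * s x ^ 2, hv, by simp [hsy], ?_, ?_⟩
  · have hval : divGrad A (fun x ↦ s x + N * s x ^ 2) y = divGrad A s y + N * (2 * q) := by
      rw [divGrad_add hAy hs.contDiffAt hNs.contDiffAt]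
      congr 1
      have h := divGrad_clm_comp hAy (hs.pow 2).contDiffAt (ContinuousLinearMap.mul ℝ ℝ N)
      simp only [ContinuousLinearMap.mul_apply'] at h
      rw [h, divGrad_sq hAy hs.contDiffAt, hsy]
      simp [q]
    have hc := (continuousOn_divGrad hΩ hA hv.contDiffOn).continuousAt (hΩ.mem_nhds hy)
    refine hc.eventually (lt_mem_nhds ?_)
    rw [hval]
    exact hN
  · have hc : Continuous fun x ↦ 1 + N * s x :=
      continuous_const.add (continuous_const.mul hs.continuous)
    have : ∀ᶠ x in nhds y, 0 < 1 + N * s x := by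
      refine hc.continuousAt.eventually (lt_mem_nhds ?_)
      simp [hsy]
    filter_upwards [this] with x hx hd
    have hsx : s x < 0 := by
      rw [dist_eq_norm, dist_eq_norm] at hd
      have := norm_nonneg (y - z)
      simp only [s]
      nlinarith
    nlinarith

theorem not_isMaxOn_of_touching_ball (hΩ : IsOpen Ω)
    (hA : ∀ i j, ContDiffOn ℝ 1 (fun y ↦ A y i j) Ω) (hpos : ∀ x ∈ Ω, (A x).PosDef)
    (hu : ContDiffOn ℝ 2 u Ω) (hD : ∀ x ∈ Ω, 0 ≤ divGrad A u x) {y z : Model n} (hy : y ∈ Ω)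
    (hyz : y ≠ z) (hball : ∀ x ∈ Ω, dist x z ≤ dist y z → x ≠ y → u x < u y) :
    ¬ IsMaxOn u Ω y := by
  intro hmax
  obtain ⟨v, hv, hvy, hDv, hvneg⟩ := exists_barrier hΩ hA hy (hpos y hy) hyz
  obtain ⟨r, hr, hrs⟩ := Metric.nhds_basis_closedBall.eventually_iff.1
    ((hΩ.eventually_mem hy).and (hDv.and hvneg))
  have hrΩ : Metric.closedBall y r ⊆ Ω := fun x hx ↦ (hrs hx).1
  have huc : ContinuousOn u (Metric.closedBall y r) := hu.continuousOn.mono hrΩ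
  obtain ⟨C, hC⟩ := (isCompact_closedBall y r).bddAbove_image hv.continuous.continuousOn
  have hC' : ∀ x ∈ Metric.closedBall y r, v x ≤ C := fun x hx ↦ hC ⟨x, hx, rfl⟩
  have hC0 : 0 ≤ C := hvy ▸ hC' y (Metric.mem_closedBall_self hr.le)
  obtain ⟨δ, hδ, hδu⟩ : ∃ δ > 0, ∀ x ∈ Metric.sphere y r, dist x z ≤ dist y z →
      u x ≤ u y - δ := by
    have hK : IsCompact (Metric.sphere y r ∩ Metric.closedBall z (dist y z)) :=
      (isCompact_sphere y r).inter_right Metric.isClosed_closedBall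
    rcases (Metric.sphere y r ∩ Metric.closedBall z (dist y z)).eq_empty_or_nonempty with h | h
    · refine ⟨1, one_pos, fun x hx hxz ↦ ?_⟩
      exact absurd (show x ∈ Metric.sphere y r ∩ Metric.closedBall z (dist y z) from ⟨hx, hxz⟩)
        (by simp [h])
    · obtain ⟨k, hk, hkmax⟩ := hK.exists_isMaxOn h
        (huc.mono (Set.inter_subset_left.trans Metric.sphere_subset_closedBall))
      refine ⟨u y - u k, sub_pos.2 (hball k (hrΩ (Metric.sphere_subset_closedBall hk.1)) hk.2
        (Metric.ne_of_mem_sphere hk.1 hr.ne')), fun x hx hxz ↦ ?_⟩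
      simpa using hkmax (show x ∈ _ ∩ _ from ⟨hx, hxz⟩)
  let ε := δ / (C + 1)
  have hε : 0 < ε := by positivity
  have hεC : ε * C < δ := by
    rw [div_mul_eq_mul_div, div_lt_iff₀ (by positivity)]
    nlinarith
  have hεv : ContDiff ℝ 2 (fun x ↦ ε * v x) := contDiff_const.mul hv
  obtain ⟨x, hx, hxmax⟩ := (isCompact_closedBall y r).exists_isMaxOn
    ⟨y, Metric.mem_closedBall_self hr.le⟩ (huc.add hεv.continuous.continuousOn)
  have hhy : u y ≤ u x + ε * v x := by
    simpa [hvy] using hxmax (Metric.mem_closedBall_self hr.le)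
  have hxball : x ∈ Metric.ball y r := by
    by_contra hxb
    have hxs : x ∈ Metric.sphere y r := by
      rw [← Metric.closedBall_sdiff_ball]; exact ⟨hx, hxb⟩
    rcases le_or_gt (dist x z) (dist y z) with h | h
    · have := hδu x hxs h
      have := mul_le_mul_of_nonneg_left (hC' x hx) hε.le
      linarith
    · have h1 : u x ≤ u y := hmax (hrΩ hx)
      have := mul_pos_of_neg_of_neg ((hrs hx).2.2 h) (neg_neg_of_pos hε)
      nlinarith
  have hloc : IsLocalMax (fun x ↦ u x + ε * v x) x :=
    hxmax.isLocalMax (Filter.mem_of_superset (Metric.isOpen_ball.mem_nhds hxball)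
      Metric.ball_subset_closedBall)
  have hxΩ : x ∈ Ω := hrΩ hx
  have hAx : ∀ i j, DifferentiableAt ℝ (fun y ↦ A y i j) x := fun i j ↦
    ((hA i j).contDiffAt (hΩ.mem_nhds hxΩ)).differentiableAt (by norm_num)
  have hux := hu.contDiffAt (hΩ.mem_nhds hxΩ)
  have hle := divGrad_nonpos_of_isLocalMax hAx (hpos x hxΩ).posSemidef
    (hux.add hεv.contDiffAt) hloc
  have h := divGrad_clm_comp hAx hv.contDiffAt (ContinuousLinearMap.mul ℝ ℝ ε)
  simp only [ContinuousLinearMap.mul_apply'] at h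
  rw [divGrad_add hAx hux hεv.contDiffAt, h] at hle
  have := mul_pos hε (hrs hx).2.1
  have := hD x hxΩ
  linarith

/-- The strong maximum principle for subsolutions of an elliptic operator in divergence form. -/
theorem eventually_eq_of_isMaxOn_of_divGrad_nonneg (hΩ : IsOpen Ω)
    (hA : ∀ i j, ContDiffOn ℝ 1 (fun y ↦ A y i j) Ω) (hpos : ∀ x ∈ Ω, (A x).PosDef)
    (hu : ContDiffOn ℝ 2 u Ω) (hD : ∀ x ∈ Ω, 0 ≤ divGrad A u x) {x₀ : Model n} (hx₀ : x₀ ∈ Ω)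
    (hmax : IsMaxOn u Ω x₀) : ∀ᶠ x in nhds x₀, u x = u x₀ := by
  obtain ⟨R, hR, hRΩ⟩ := Metric.nhds_basis_closedBall.mem_iff.1 (hΩ.mem_nhds hx₀)
  by_contra hne
  obtain ⟨z, hz, hzu⟩ : ∃ z ∈ Metric.ball x₀ (R / 2), u z ≠ u x₀ := by
    by_contra! h
    exact hne (Filter.mem_of_superset (Metric.ball_mem_nhds x₀ (half_pos hR)) h)
  let S := Metric.closedBall x₀ R ∩ u ⁻¹' {u x₀}
  have hS : IsClosed S :=
    (hu.continuousOn.mono hRΩ).preimage_isClosed_of_isClosed Metric.isClosed_closedBall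
      isClosed_singleton
  have hx₀S : x₀ ∈ S := ⟨Metric.mem_closedBall_self hR.le, rfl⟩
  obtain ⟨y, hyS, hyz⟩ := hS.exists_infDist_eq_dist ⟨x₀, hx₀S⟩ z
  have hmin : ∀ x ∈ S, dist y z ≤ dist x z := fun x hx ↦ by
    rw [dist_comm y z, ← hyz, dist_comm x z]
    exact Metric.infDist_le_dist_of_mem hx
  have huy : u y = u x₀ := hyS.2
  have hyne : y ≠ z := by rintro rfl; exact hzu huy
  have hyb : y ∈ Metric.ball x₀ R := by
    rw [Metric.mem_ball] at hz ⊢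
    have := hmin x₀ hx₀S
    have := dist_triangle y z x₀
    rw [dist_comm x₀ z] at *
    linarith
  have hsub : Metric.ball x₀ R ⊆ Ω := Metric.ball_subset_closedBall.trans hRΩ
  refine not_isMaxOn_of_touching_ball (z := midpoint ℝ y z) Metric.isOpen_ball
    (fun i j ↦ (hA i j).mono hsub) (fun x hx ↦ hpos x (hsub hx)) (hu.mono hsub)
    (fun x hx ↦ hD x (hsub hx)) hyb (by simpa [eq_comm] using hyne) ?_ ?_
  · intro x hx hxd hxy
    have hle : u x ≤ u y := huy ▸ hmax (hsub hx)
    refine lt_of_le_of_ne hle fun hxu ↦ hxy ?_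
    have h := hmin x ⟨Metric.ball_subset_closedBall hx, hxu.trans huy⟩
    set m := midpoint ℝ y z with hm
    have hzm : z = m - (y - m) := by
      have := midpoint_add_self ℝ y z
      rw [← hm] at this
      rw [sub_sub_eq_add_sub, this]; abel
    rw [dist_eq_norm, dist_eq_norm] at h hxd
    have e1 : y - z = (2 : ℝ) • (y - m) := by rw [two_smul, hzm]; abel
    have e2 : x - z = (x - m) + (y - m) := by rw [hzm]; abel
    have e3 : x - y = (x - m) - (y - m) := by abel
    have hp := parallelogram_law_with_norm ℝ (x - m) (y - m)
    rw [e1, e2, norm_smul, Real.norm_two] at h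
    rw [← sub_eq_zero, ← norm_eq_zero, e3]
    have h0 := norm_nonneg ((x - m) - (y - m))
    have h1 := norm_nonneg (x - m)
    have h2 := norm_nonneg (y - m)
    nlinarith
  · intro x hx
    simpa [huy] using hmax (hsub hx)

end MaximumPrinciple

section Eigenfamily

variable {n : ℕ} {M : Type*} [TopologicalSpace M] [ChartedSpace (Model n) M]
  [IsManifold (𝓡 n) ∞ M] {g : Metric n M} {lam mu : ℂ} {e : OpenPartialHomeomorph M (Model n)}

/-- The coefficient matrix `(g^ij √|g|)` of the Laplace-Beltrami operator in the chart `e`. -/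
noncomputable def coeffMatrix (g : Metric n M) (e : OpenPartialHomeomorph M (Model n))
    (y : Model n) : Matrix (Fin n) (Fin n) ℝ :=
  density g e y • (metricMatrix g e y)⁻¹

theorem density_pos (he : e ∈ atlas (Model n) M) {y : Model n} (hy : y ∈ e.target) :
    0 < density g e y :=
  Real.sqrt_pos.2 (posDef_metricMatrix g he hy).det_pos

theorem posDef_coeffMatrix (he : e ∈ atlas (Model n) M) {y : Model n} (hy : y ∈ e.target) :
    (coeffMatrix g e y).PosDef :=
  (posDef_metricMatrix g he hy).inv.smul (density_pos he hy)

theorem contDiffOn_coeffMatrix (he : e ∈ atlas (Model n) M) (i j : Fin n) :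
    ContDiffOn ℝ 1 (fun y ↦ coeffMatrix g e y i j) e.target := by
  refine (contDiffOn_inv_mul_sqrt_det (contDiffOn_metricMatrix g he)
    (fun y hy ↦ (posDef_metricMatrix g he hy).det_pos.ne') i j).congr fun y _ ↦ ?_
  simp [coeffMatrix, density, mul_comm]

theorem differentiableAt_coeffMatrix (he : e ∈ atlas (Model n) M) {y : Model n}
    (hy : y ∈ e.target) (i j : Fin n) :
    DifferentiableAt ℝ (fun y ↦ coeffMatrix g e y i j) y :=
  ((contDiffOn_coeffMatrix he i j).contDiffAt (e.open_target.mem_nhds hy)).differentiableAt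
    (by norm_num)

theorem tau_eq_divGrad (φ : M → ℂ) (p : M) :
    tau g e φ p = ((1 / density g e (e p) : ℝ) : ℂ) *
      divGrad (coeffMatrix g e) (φ ∘ e.symm) (e p) := by
  simp only [tau, divGrad, partialDeriv, Finset.mul_sum, coeffMatrix, Matrix.smul_apply,
    smul_eq_mul, Complex.real_smul, mul_comm (density g e _)]

theorem tau_eq_iff (he : e ∈ atlas (Model n) M) {p : M} (hp : p ∈ e.source) (φ : M → ℂ) (c : ℂ) :
    tau g e φ p = c ↔
      divGrad (coeffMatrix g e) (φ ∘ e.symm) (e p) = (density g e (e p) : ℂ) * c := by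
  have h : (density g e (e p) : ℂ) ≠ 0 :=
    Complex.ofReal_ne_zero.2 (density_pos he (e.map_source hp)).ne'
  rw [tau_eq_divGrad, Complex.ofReal_div, Complex.ofReal_one, one_div, inv_mul_eq_iff_eq_mul₀ h]

theorem contDiffOn_comp_symm {φ : M → ℂ} (hφ : ContMDiff (𝓡 n) 𝓘(ℝ, ℂ) 2 φ)
    (he : e ∈ atlas (Model n) M) : ContDiffOn ℝ 2 (φ ∘ e.symm) e.target :=
  contMDiffOn_iff_contDiffOn.1 (hφ.comp_contMDiffOn
    ((contMDiffOn_chart_symm_of_mem_atlas he).of_le (by norm_cast)))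

theorem IsEigenfamily.linearCombination {F : Set (M → ℂ)} (hF : IsEigenfamily g lam mu F)
    {φ ψ : M → ℂ} (hφ : φ ∈ F) (hψ : ψ ∈ F) (a b : ℂ) :
    IsEigenfamily g lam mu {fun p ↦ a * φ p + b * ψ p} := by
  have hφd := hF.contMDiff φ hφ
  have hψd := hF.contMDiff ψ hψ
  refine ⟨?_, ?_, ?_⟩
  · rintro _ rfl
    have h : ContDiff ℝ 2 (fun z : ℂ × ℂ ↦ a * z.1 + b * z.2) := by fun_prop
    exact h.contMDiff.comp (hφd.prodMk_space hψd)
  · rintro _ rfl e he p hp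
    have hp' := e.map_source hp
    have hφ2 := (contDiffOn_comp_symm hφd he).contDiffAt (e.open_target.mem_nhds hp')
    have hψ2 := (contDiffOn_comp_symm hψd he).contDiffAt (e.open_target.mem_nhds hp')
    have hA := differentiableAt_coeffMatrix (g := g) he hp'
    rw [tau_eq_iff he hp]
    have h1 := divGrad_clm_comp hA hφ2 (ContinuousLinearMap.mul ℝ ℂ a)
    have h2 := divGrad_clm_comp hA hψ2 (ContinuousLinearMap.mul ℝ ℂ b)
    have h3 := divGrad_add hA
      ((ContinuousLinearMap.mul ℝ ℂ a).contDiff.contDiffAt.comp _ hφ2)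
      ((ContinuousLinearMap.mul ℝ ℂ b).contDiff.contDiffAt.comp _ hψ2)
    simp only [Function.comp_def, ContinuousLinearMap.mul_apply'] at h1 h2 h3 ⊢
    have h4 := (tau_eq_iff he hp φ _).1 (hF.tau_eq φ hφ e he p hp)
    have h5 := (tau_eq_iff he hp ψ _).1 (hF.tau_eq ψ hψ e he p hp)
    simp only [Function.comp_def] at h4 h5
    rw [h3, h1, h2, h4, h5]
    ring
  · rintro _ rfl _ rfl e he p hp
    have hp' := e.map_source hp
    have hφ1 := ((contDiffOn_comp_symm hφd he).contDiffAt
      (e.open_target.mem_nhds hp')).differentiableAt (by norm_num)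
    have hψ1 := ((contDiffOn_comp_symm hψd he).contDiffAt
      (e.open_target.mem_nhds hp')).differentiableAt (by norm_num)
    have hd : ∀ i, partialDeriv i ((fun p ↦ a * φ p + b * ψ p) ∘ e.symm) (e p) =
        a * partialDeriv i (φ ∘ e.symm) (e p) + b * partialDeriv i (ψ ∘ e.symm) (e p) := by
      intro i
      have := ((hφ1.hasFDerivAt.const_mul a).fun_add (hψ1.hasFDerivAt.const_mul b)).fderiv
      simp only [partialDeriv, Function.comp_def] at this ⊢
      rw [this]
      simp
    have k : kappa g e (fun p ↦ a * φ p + b * ψ p) (fun p ↦ a * φ p + b * ψ p) p =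
        a * a * kappa g e φ φ p + a * b * kappa g e φ ψ p + b * a * kappa g e ψ φ p +
          b * b * kappa g e ψ ψ p := by
      simp only [kappa, hd, Finset.mul_sum, ← Finset.sum_add_distrib]
      exact Finset.sum_congr rfl fun _ _ ↦ Finset.sum_congr rfl fun _ _ ↦ by ring
    rw [k, hF.kappa_eq φ hφ φ hφ e he p hp, hF.kappa_eq φ hφ ψ hψ e he p hp,
      hF.kappa_eq ψ hψ φ hφ e he p hp, hF.kappa_eq ψ hψ ψ hψ e he p hp]
    ring

/-- The modulus of `g(v, v)` for the complex bilinear extension of a positive semidefinite form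
is at most the value of its Hermitian extension at `v`. -/
theorem norm_sum_sum_le_of_posSemidef {B : Matrix (Fin n) (Fin n) ℝ} (hB : B.PosSemidef)
    (v : Fin n → ℂ) :
    ‖∑ i, ∑ j, (B i j : ℂ) * v i * v j‖ ≤
      ∑ i, ∑ j, B i j * (v i).re * (v j).re + ∑ i, ∑ j, B i j * (v i).im * (v j).im := by
  set X := ∑ i, ∑ j, B i j * (v i).re * (v j).re with hX
  set Y := ∑ i, ∑ j, B i j * (v i).im * (v j).im with hY
  set W := ∑ i, ∑ j, B i j * ((v i).re * (v j).im + (v i).im * (v j).re) with hW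
  have hnn : ∀ w : Fin n → ℝ, 0 ≤ ∑ i, ∑ j, B i j * w i * w j := fun w ↦ by
    rw [sum_sum_mul_eq_dotProduct]
    exact hB.dotProduct_mulVec_nonneg w
  have hX0 : 0 ≤ X := hnn fun i ↦ (v i).re
  have hY0 : 0 ≤ Y := hnn fun i ↦ (v i).im
  have hdisc : discrim X W Y ≤ 0 := by
    refine discrim_le_zero fun t ↦ (hnn fun i ↦ t * (v i).re + (v i).im).trans_eq ?_
    simp only [hX, hY, hW, Finset.sum_mul, ← Finset.sum_add_distrib]
    exact Finset.sum_congr rfl fun _ _ ↦ Finset.sum_congr rfl fun _ _ ↦ by ring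
  have hval : ∑ i, ∑ j, (B i j : ℂ) * v i * v j = ⟨X - Y, W⟩ := by
    apply Complex.ext
    · simp only [Complex.re_sum, hX, hY, ← Finset.sum_sub_distrib]
      refine Finset.sum_congr rfl fun _ _ ↦ Finset.sum_congr rfl fun _ _ ↦ ?_
      simp
    · simp only [Complex.im_sum, hW]
      refine Finset.sum_congr rfl fun _ _ ↦ Finset.sum_congr rfl fun _ _ ↦ ?_
      simp
      ring
  rw [hval]
  refine abs_le_of_sq_le_sq' ?_ (by positivity) |>.2
  rw [← Complex.normSq_eq_norm_sq, Complex.normSq_mk]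
  rw [discrim] at hdisc
  nlinarith

theorem IsEigenfamily.divGrad_normSq_nonneg {χ : M → ℂ} (hχ : IsEigenfamily g lam lam {χ})
    (he : e ∈ atlas (Model n) M) {y : Model n} (hy : y ∈ e.target) :
    0 ≤ divGrad (coeffMatrix g e) (fun y ↦ Complex.normSq (χ (e.symm y))) y := by
  have hA := differentiableAt_coeffMatrix (g := g) he hy
  have hf := (contDiffOn_comp_symm (hχ.contMDiff χ rfl) he).contDiffAt (e.open_target.mem_nhds hy)
  have hp := e.map_target hy
  have htau := (tau_eq_iff he hp χ _).1 (hχ.tau_eq χ rfl e he _ hp)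
  have hkap := hχ.kappa_eq χ rfl χ rfl e he _ hp
  simp only [kappa, partialDeriv] at hkap
  rw [e.right_inv hy] at htau hkap
  set f := χ ∘ e.symm with hfdef
  have hre : ContDiffAt ℝ 2 (fun y ↦ Complex.reCLM (f y)) y :=
    Complex.reCLM.contDiff.contDiffAt.comp y hf
  have him : ContDiffAt ℝ 2 (fun y ↦ Complex.imCLM (f y)) y :=
    Complex.imCLM.contDiff.contDiffAt.comp y hf
  have hf1 := (hf.differentiableAt (by norm_num)).hasFDerivAt
  have dre : fderiv ℝ (fun y ↦ Complex.reCLM (f y)) y = Complex.reCLM.comp (fderiv ℝ f y) :=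
    (Complex.reCLM.hasFDerivAt.comp y hf1).fderiv
  have dim : fderiv ℝ (fun y ↦ Complex.imCLM (f y)) y = Complex.imCLM.comp (fderiv ℝ f y) :=
    (Complex.imCLM.hasFDerivAt.comp y hf1).fderiv
  have hfun : (fun y ↦ Complex.normSq (χ (e.symm y))) =
      fun y ↦ Complex.reCLM (f y) ^ 2 + Complex.imCLM (f y) ^ 2 := by
    ext y
    simp [hfdef, Complex.normSq_apply, sq]
  have hpd := posDef_metricMatrix g he hy
  have hnorm := norm_sum_sum_le_of_posSemidef hpd.inv.posSemidef
    fun i ↦ fderiv ℝ f y (EuclideanSpace.single i (1 : ℝ))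
  rw [hkap] at hnorm
  have hρ := density_pos (g := g) he hy
  rw [hfun, divGrad_add hA (hre.pow 2) (him.pow 2), divGrad_sq hA hre, divGrad_sq hA him,
    divGrad_clm_comp hA hf, divGrad_clm_comp hA hf, htau, dre, dim]
  simp only [coeffMatrix, Matrix.smul_apply, smul_eq_mul, mul_assoc, ← Finset.mul_sum,
    ContinuousLinearMap.comp_apply, Complex.reCLM_apply, Complex.imCLM_apply] at hnorm ⊢
  set X := ∑ i, ∑ j, (metricMatrix g e y)⁻¹ i j *
    ((fderiv ℝ f y (EuclideanSpace.single i (1 : ℝ))).re *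
      (fderiv ℝ f y (EuclideanSpace.single j (1 : ℝ))).re)
  set Y := ∑ i, ∑ j, (metricMatrix g e y)⁻¹ i j *
    ((fderiv ℝ f y (EuclideanSpace.single i (1 : ℝ))).im *
      (fderiv ℝ f y (EuclideanSpace.single j (1 : ℝ))).im)
  have hfy : χ (e.symm y) = f y := rfl
  rw [hfy] at hnorm ⊢
  have hn : ‖lam * (f y * f y)‖ = ‖lam‖ * ((f y).re ^ 2 + (f y).im ^ 2) := by
    rw [norm_mul, norm_mul, Complex.norm_mul_self_eq_normSq, Complex.normSq_apply]
    ring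
  rw [hn] at hnorm
  have hl := neg_le_of_abs_le (Complex.abs_re_le_norm lam)
  have hkey : 0 ≤ lam.re * ((f y).re ^ 2 + (f y).im ^ 2) + (X + Y) := by
    nlinarith [sq_nonneg (f y).re, sq_nonneg (f y).im]
  have := mul_nonneg hρ.le hkey
  simp only [Complex.ofReal_re, Complex.ofReal_im, Complex.mul_re, Complex.mul_im]
  linarith

theorem IsEigenfamily.normSq_eq [CompactSpace M] [ConnectedSpace M] {χ : M → ℂ}
    (hχ : IsEigenfamily g lam lam {χ}) (p q : M) :
    Complex.normSq (χ p) = Complex.normSq (χ q) := by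
  have hd := hχ.contMDiff χ rfl
  have hc : Continuous fun p ↦ Complex.normSq (χ p) := Complex.continuous_normSq.comp hd.continuous
  obtain ⟨p₀, -, hp₀⟩ := isCompact_univ.exists_isMaxOn Set.univ_nonempty hc.continuousOn
  have hclopen : IsClopen {p | Complex.normSq (χ p) = Complex.normSq (χ p₀)} := by
    refine ⟨isClosed_eq hc continuous_const, isOpen_iff_mem_nhds.2 fun p hp ↦ ?_⟩
    let e := chartAt (Model n) p
    have he : e ∈ atlas (Model n) M := chart_mem_atlas _ p
    have hps : p ∈ e.source := mem_chart_source _ p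
    have hns : ContDiff ℝ 2 (fun z : ℂ ↦ Complex.normSq z) := by
      simp only [Complex.normSq_apply]
      exact (Complex.reCLM.contDiff.mul Complex.reCLM.contDiff).add
        (Complex.imCLM.contDiff.mul Complex.imCLM.contDiff)
    have hloc := eventually_eq_of_isMaxOn_of_divGrad_nonneg (A := coeffMatrix g e)
      (u := fun y ↦ Complex.normSq (χ (e.symm y))) e.open_target (contDiffOn_coeffMatrix he)
      (fun y hy ↦ posDef_coeffMatrix he hy)
      (hns.comp_contDiffOn (contDiffOn_comp_symm hd he))
      (fun y hy ↦ hχ.divGrad_normSq_nonneg he hy) (e.map_source hps)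
      (fun y _ ↦ by
        simp only [Set.mem_ofPred_eq, e.left_inv hps]
        rw [hp]
        exact hp₀ (Set.mem_univ _))
    filter_upwards [(e.continuousAt hps).eventually hloc, e.open_source.mem_nhds hps] with q hq hqs
    rw [e.left_inv hqs, e.left_inv hps] at hq
    exact hq.trans hp
  have huniv := hclopen.eq_univ ⟨p₀, rfl⟩
  have h : ∀ p, Complex.normSq (χ p) = Complex.normSq (χ p₀) := fun p ↦
    Set.eq_univ_iff_forall.1 huniv p
  rw [h p, h q]

theorem IsEigenfamily.eq_smul [CompactSpace M] [ConnectedSpace M] {F : Set (M → ℂ)}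
    (hF : IsEigenfamily g lam lam F) {φ ψ : M → ℂ} (hφ : φ ∈ F) (hψ : ψ ∈ F) {p : M}
    (hp : φ p ≠ 0) : ψ = (ψ p / φ p) • φ := by
  ext q
  have h := (hF.linearCombination hφ hψ (ψ p) (-φ p)).normSq_eq q p
  have h0 : ψ p * φ p + -φ p * ψ p = 0 := by ring
  rw [h0, map_zero, Complex.normSq_eq_zero] at h
  simp only [Pi.smul_apply, smul_eq_mul]
  field_simp
  linear_combination -h

end Eigenfamily

end Eigenfamily

theorem proposition1p2 {n : ℕ} {M : Type*} [TopologicalSpace M] [T2Space M] [CompactSpace M]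
    [ConnectedSpace M] [ChartedSpace (Eigenfamily.Model n) M] [IsManifold (𝓡 n) ∞ M]
    (g : Eigenfamily.Metric n M) (lam : ℂ) (F : Set (M → ℂ))
    (hF : Eigenfamily.IsEigenfamily g lam lam F) :
    Module.rank ℂ (Submodule.span ℂ F) ≤ 1 := by
  rw [rank_submodule_le_one_iff']
  by_cases h : ∃ φ ∈ F, ∃ p, φ p ≠ 0
  · obtain ⟨φ, hφ, p, hp⟩ := h
    refine ⟨φ, Submodule.span_le.2 fun ψ hψ ↦ ?_⟩
    rw [hF.eq_smul hφ hψ hp]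
    exact Submodule.smul_mem _ _ (Submodule.mem_span_singleton_self φ)
  · push Not at h
    refine ⟨0, Submodule.span_le.2 fun ψ hψ ↦ ?_⟩
    rw [show ψ = 0 from funext (h ψ hψ)]
    exact Submodule.zero_mem _
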